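/- Let $f(z)=\sum_{k=0}^\infty a_k z^k$ be an entire function with $a_k>0$ for all $k\ge 0$, and let $q_n = \dfrac{a_{n-1}^2}{a_{n-2}\,a_n}$ for $n\ge 2$ be the second quotients of its Taylor coefficients. Suppose that $$2\sqrt[3]{2}\;\le\; q_2\;\le\; q_3\;\le\; q_4\;\le\;\cdots .$$ Then all but finitely many zeros of $f$ in $\mathbb{C}$ are real and simple; that is, the set of zeros of $f$ that are non-real or multiple is finite. -/

import Mathlib

/-- The second quotients `q_n = a_{n-1}^2 / (a_{n-2} a_n)` of a sequence of Taylor coefficients.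
They are meant, and used, for `n ≥ 2` only. -/
noncomputable def secondQuotient (a : ℕ → ℝ) (n : ℕ) : ℝ :=
  a (n - 1) ^ 2 / (a (n - 2) * a n)

/-- `z` is a simple zero of `f`: `f` vanishes at `z` to order exactly one. -/
def IsSimpleZero (f : ℂ → ℂ) (z : ℂ) : Prop :=
  AnalyticAt ℂ f z ∧ analyticOrderAt f z = 1

open Filter Topology

/-! Put ρ_k = a_k / a_{k+1}. Since ρ_k / ρ_{k+1} = 1 / q_{k+2} is nonincreasing and at most 2/5, it
has a limit t in [0, 2/5], and ρ_k → ∞. A disc contains finitely many zeros, so infinitely many bad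
(non-real or multiple) zeros would yield bad zeros z_m → ∞. Choose v with ρ_v ≤ |z_m| < ρ_{v+1},
divide the series by its largest term, of index v + 1, and write u = z_m / |z_m|. Along a
subsequence |z_m| / ρ_{v+1} → α, ρ_v / |z_m| → β and u → u₀, with αβ = t, and the equation f(z_m) =
0 becomes 1 + ∑_{n ≥ 1} t^{n(n-1)/2} (x^n + y^n) = 0, where x = αu₀, y = β·conj u₀ and xy = t.

Badness gives a second equation that also passes to the limit: the difference quotient of the series
between u and its conjugate vanishes, or the derivative does if u is real
(`hasSum_conjDivDiff_eq_zero`).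

By the Jacobi triple product the theta series vanishes only if some 1 + t^i x or 1 + t^i y does
(`exists_of_one_add_tsum_eq_zero`). As |x|, |y| ≤ 1 and t < 1, this forces x = -1 or y = -1, hence
u₀ = -1. But that zero of the theta series is simple (`tsum_alternating_theta_pos`), against the
second equation; `false_of_tendsto_theta` assembles this contradiction. -/

/-- The finite `q`-Pochhammer product `(t; t)_n`. -/
def qPochhammer {K : Type*} [CommRing K] (t : K) (n : ℕ) : K :=
  ∏ i ∈ Finset.range n, (1 - t ^ (i + 1))

/-- The Gaussian binomial coefficient, as a quotient of `q`-Pochhammer products. -/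
def gaussBinom {K : Type*} [Field K] (t : K) (N k : ℕ) : K :=
  if k ≤ N then qPochhammer t N / (qPochhammer t k * qPochhammer t (N - k)) else 0

/-- The bilateral monomials of the theta series in the two variables `x`, `y` with `x * y = t`. -/
def thetaTerm {K : Type*} [CommRing K] (t x y : K) : ℤ → K
  | Int.ofNat n => t ^ (n.choose 2) * x ^ n
  | Int.negSucc n => t ^ ((n + 1).choose 2) * y ^ (n + 1)

/-! ### Gaussian binomials and the finite Jacobi triple product. -/

section Algebra

variable {K : Type*} [Field K] {t : K}

lemma qPochhammer_succ (n : ℕ) : qPochhammer t (n + 1) = qPochhammer t n * (1 - t ^ (n + 1)) :=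
  Finset.prod_range_succ _ _

lemma qPochhammer_ne_zero (ht : ∀ n : ℕ, 1 - t ^ (n + 1) ≠ 0) (n : ℕ) : qPochhammer t n ≠ 0 :=
  Finset.prod_ne_zero_iff.2 fun i _ => ht i

lemma gaussBinom_add (k l : ℕ) :
    gaussBinom t (k + l) k = qPochhammer t (k + l) / (qPochhammer t k * qPochhammer t l) := by
  simp [gaussBinom]

lemma gaussBinom_of_lt {N k : ℕ} (h : N < k) : gaussBinom t N k = 0 := by
  simp [gaussBinom, h]

lemma gaussBinom_zero_right (ht : ∀ n : ℕ, 1 - t ^ (n + 1) ≠ 0) (N : ℕ) :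
    gaussBinom t N 0 = 1 := by
  have := div_self (qPochhammer_ne_zero ht N)
  simpa [gaussBinom, qPochhammer] using this

lemma gaussBinom_self (ht : ∀ n : ℕ, 1 - t ^ (n + 1) ≠ 0) (N : ℕ) :
    gaussBinom t N N = 1 := by
  have := div_self (qPochhammer_ne_zero ht N)
  simpa [gaussBinom, qPochhammer] using this

lemma gaussBinom_succ_succ (ht : ∀ n : ℕ, 1 - t ^ (n + 1) ≠ 0) {N k : ℕ} (hk : k ≤ N) :
    gaussBinom t (N + 1) (k + 1) = gaussBinom t N (k + 1) + t ^ (N - k) * gaussBinom t N k := by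
  obtain ⟨l, rfl⟩ := Nat.exists_eq_add_of_le hk
  rcases l with _ | l
  · simp [gaussBinom_self ht, gaussBinom_of_lt]
  have h1 := gaussBinom_add (t := t) (k + 1) (l + 1)
  have h2 := gaussBinom_add (t := t) (k + 1) l
  have h3 := gaussBinom_add (t := t) k (l + 1)
  rw [show k + 1 + (l + 1) = k + (l + 1) + 1 by ring] at h1
  rw [show k + 1 + l = k + (l + 1) by ring] at h2
  rw [h1, h2, h3, qPochhammer_succ, qPochhammer_succ, qPochhammer_succ]
  have a1 := qPochhammer_ne_zero ht k
  have a2 := qPochhammer_ne_zero ht l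
  have a3 := ht k
  have a4 := ht l
  rw [show k + (l + 1) - k = l + 1 by omega]
  field_simp
  ring

lemma gaussBinom_succ_succ' (ht : ∀ n : ℕ, 1 - t ^ (n + 1) ≠ 0) {N k : ℕ} (hk : k ≤ N) :
    gaussBinom t (N + 1) (k + 1) = t ^ (k + 1) * gaussBinom t N (k + 1) + gaussBinom t N k := by
  obtain ⟨l, rfl⟩ := Nat.exists_eq_add_of_le hk
  rcases l with _ | l
  · simp [gaussBinom_self ht, gaussBinom_of_lt]
  have h1 := gaussBinom_add (t := t) (k + 1) (l + 1)
  have h2 := gaussBinom_add (t := t) (k + 1) l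
  have h3 := gaussBinom_add (t := t) k (l + 1)
  rw [show k + 1 + (l + 1) = k + (l + 1) + 1 by ring] at h1
  rw [show k + 1 + l = k + (l + 1) by ring] at h2
  rw [h1, h2, h3, qPochhammer_succ, qPochhammer_succ, qPochhammer_succ]
  have a1 := qPochhammer_ne_zero ht k
  have a2 := qPochhammer_ne_zero ht l
  have a3 := ht k
  have a4 := ht l
  field_simp
  ring

lemma succ_choose_two (n : ℕ) : (n + 1).choose 2 = n + n.choose 2 := by
  rw [Nat.choose_succ_succ' n 1, Nat.choose_one_right]

lemma thetaTerm_ofNat (x y : K) (n : ℕ) : thetaTerm t x y (n : ℤ) = t ^ (n.choose 2) * x ^ n := rfl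

lemma thetaTerm_neg (x y : K) (n : ℕ) :
    thetaTerm t x y (-(n : ℤ)) = t ^ (n.choose 2) * y ^ n := by
  rcases n with _ | n
  · simp [thetaTerm]
  · rfl

/-- A new factor in `x` moves each monomial one step to the right; at negative indices the step
cancels a `y` through x y = t. No inverse of `x` or `t` occurs, so t = 0 is allowed. -/
lemma mul_thetaTerm_of_le {x y : K} (hxy : x * y = t) {m n k : ℕ} (hk : k ≤ m + n) :
    t ^ m * x * thetaTerm t x y ((k : ℤ) - n) =
      t ^ (m + n - k) * thetaTerm t x y ((k : ℤ) - n + 1) := by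
  rcases le_or_gt n k with h | h
  · obtain ⟨j, rfl⟩ := Nat.exists_eq_add_of_le h
    obtain ⟨i, rfl⟩ := Nat.exists_eq_add_of_le (show j ≤ m by omega)
    rw [show ((n + j : ℕ) : ℤ) - n = (j : ℕ) by push_cast; ring,
      show ((j : ℕ) : ℤ) + 1 = ((j + 1 : ℕ) : ℤ) by push_cast; ring, thetaTerm_ofNat,
      thetaTerm_ofNat, succ_choose_two, show j + i + n - (n + j) = i by omega]
    ring
  · obtain ⟨j, rfl⟩ := Nat.exists_eq_add_of_lt h
    rw [show ((k : ℕ) : ℤ) - (k + j + 1 : ℕ) = -((j + 1 : ℕ) : ℤ) by push_cast; ring,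
      show -((j + 1 : ℕ) : ℤ) + 1 = -(j : ℤ) by push_cast; ring, thetaTerm_neg,
      thetaTerm_neg, succ_choose_two, show m + (k + j + 1) - k = m + j + 1 by omega, ← hxy]
    ring

lemma mul_thetaTerm_of_le' {x y : K} (hxy : x * y = t) {n k : ℕ} :
    t ^ n * y * thetaTerm t x y ((k : ℤ) - n) = t ^ k * thetaTerm t x y ((k : ℤ) - n - 1) := by
  rcases le_or_gt (n + 1) k with h | h
  · obtain ⟨j, rfl⟩ := Nat.exists_eq_add_of_le h
    rw [show ((n + 1 + j : ℕ) : ℤ) - n = (j + 1 : ℕ) by push_cast; ring,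
      show ((j + 1 : ℕ) : ℤ) - 1 = ((j : ℕ) : ℤ) by push_cast; ring, thetaTerm_ofNat,
      thetaTerm_ofNat, succ_choose_two, ← hxy]
    ring
  · obtain ⟨j, rfl⟩ := Nat.exists_eq_add_of_le (Nat.lt_succ_iff.1 h)
    rw [show ((k : ℕ) : ℤ) - (k + j : ℕ) = -((j : ℕ) : ℤ) by push_cast; ring,
      show -((j : ℕ) : ℤ) - 1 = -((j + 1 : ℕ) : ℤ) by push_cast; ring, thetaTerm_neg,
      thetaTerm_neg, succ_choose_two]
    ring

/-- Unequal numbers of factors let them be added singly: a factor in `x` matches one q-Pascal rule,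
a factor in `y` the other. -/
lemma prod_mul_prod_eq_sum_gaussBinom (ht : ∀ n : ℕ, 1 - t ^ (n + 1) ≠ 0) {x y : K}
    (hxy : x * y = t) (m n : ℕ) :
    (∏ i ∈ Finset.range m, (1 + t ^ i * x)) * ∏ i ∈ Finset.range n, (1 + t ^ i * y) =
      ∑ k ∈ Finset.range (m + n + 1), gaussBinom t (m + n) k * thetaTerm t x y ((k : ℤ) - n) := by
  induction n with
  | zero =>
    induction m with
    | zero => simp [gaussBinom_self ht, thetaTerm]
    | succ m ih =>
      rw [Finset.prod_range_succ, mul_right_comm, ih, mul_add, mul_one,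
        show m + 1 + 0 = m + 0 + 1 by ring, Finset.sum_range_succ' _ (m + 0 + 1)]
      have h0 : ∑ k ∈ Finset.range (m + 0 + 1),
          gaussBinom t (m + 0) k * thetaTerm t x y ((k : ℤ) - (0 : ℕ)) =
          (∑ k ∈ Finset.range (m + 0 + 1), gaussBinom t (m + 0) (k + 1) *
            thetaTerm t x y (((k + 1 : ℕ) : ℤ) - (0 : ℕ))) +
          thetaTerm t x y (((0 : ℕ) : ℤ) - (0 : ℕ)) := by
        rw [Finset.sum_range_succ', Finset.sum_range_succ _ (m + 0), gaussBinom_zero_right ht,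
          gaussBinom_of_lt (Nat.lt_succ_self _)]
        simp only [one_mul, zero_mul, add_zero]
      rw [h0, ← h0, Finset.sum_mul, h0, add_right_comm, ← Finset.sum_add_distrib,
        gaussBinom_zero_right ht, one_mul]
      congr 1
      refine Finset.sum_congr rfl fun k hk => ?_
      have hk' : k ≤ m + 0 := Nat.lt_succ_iff.1 (Finset.mem_range.1 hk)
      have := mul_thetaTerm_of_le hxy hk'
      rw [gaussBinom_succ_succ ht hk', show (((k + 1 : ℕ) : ℤ) - (0 : ℕ)) = (k : ℤ) - (0 : ℕ) + 1 by
        push_cast; ring]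
      linear_combination gaussBinom t (m + 0) k * this
  | succ n ih =>
    rw [Finset.prod_range_succ, ← mul_assoc, ih, mul_add, mul_one,
      show m + (n + 1) = m + n + 1 by ring, Finset.sum_range_succ' _ (m + n + 1)]
    have h0 : (∑ k ∈ Finset.range (m + n + 1),
        gaussBinom t (m + n) k * thetaTerm t x y ((k : ℤ) - n)) * (t ^ n * y) =
        (∑ k ∈ Finset.range (m + n + 1), t ^ (k + 1) * gaussBinom t (m + n) (k + 1) *
          thetaTerm t x y (((k + 1 : ℕ) : ℤ) - (n + 1 : ℕ))) +
        thetaTerm t x y (((0 : ℕ) : ℤ) - (n + 1 : ℕ)) := by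
      rw [Finset.sum_mul, Finset.sum_congr rfl fun k hk => show
        gaussBinom t (m + n) k * thetaTerm t x y ((k : ℤ) - n) * (t ^ n * y) =
          t ^ k * gaussBinom t (m + n) k * thetaTerm t x y ((k : ℤ) - (n + 1 : ℕ)) by
        have := mul_thetaTerm_of_le' hxy (n := n) (k := k)
        rw [show (k : ℤ) - (n + 1 : ℕ) = (k : ℤ) - n - 1 by push_cast; ring]
        linear_combination gaussBinom t (m + n) k * this]
      rw [Finset.sum_range_succ', Finset.sum_range_succ _ (m + n), gaussBinom_zero_right ht,
        gaussBinom_of_lt (Nat.lt_succ_self _)]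
      ring
    rw [h0, ← add_assoc, ← Finset.sum_add_distrib, gaussBinom_zero_right ht, one_mul]
    congr 1
    refine Finset.sum_congr rfl fun k hk => ?_
    have hk' : k ≤ m + n := Nat.lt_succ_iff.1 (Finset.mem_range.1 hk)
    rw [gaussBinom_succ_succ' ht hk',
      show (((k + 1 : ℕ) : ℤ) - (n + 1 : ℕ)) = (k : ℤ) - n by push_cast; ring]
    ring

lemma gaussBinom_symm (N k l : ℕ) (h : k + l = N) : gaussBinom t N k = gaussBinom t N l := by
  have h1 := gaussBinom_add (t := t) k l
  have h2 := gaussBinom_add (t := t) l k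
  rw [h] at h1
  rw [add_comm, h] at h2
  rw [h1, h2, mul_comm]

/-- The finite form of the Jacobi triple product identity. -/
lemma prod_eq_gaussBinom_add_sum (ht : ∀ n : ℕ, 1 - t ^ (n + 1) ≠ 0) {x y : K}
    (hxy : x * y = t) (n : ℕ) :
    (∏ i ∈ Finset.range n, (1 + t ^ i * x)) * ∏ i ∈ Finset.range n, (1 + t ^ i * y) =
      gaussBinom t (n + n) n + ∑ j ∈ Finset.range n, gaussBinom t (n + n) (n + (j + 1)) *
        (t ^ ((j + 1).choose 2) * (x ^ (j + 1) + y ^ (j + 1))) := by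
  -- Split at the central index and reflect the lower half, so that n - (j + 1) and n + (j + 1) pair
  -- up under the symmetry of the Gaussian binomials.
  rw [prod_mul_prod_eq_sum_gaussBinom ht hxy, add_assoc, Finset.sum_range_add,
    Finset.sum_range_succ', ← Finset.sum_range_reflect]
  have h1 : ∀ j ∈ Finset.range n, gaussBinom t (n + n) (n - 1 - j) *
      thetaTerm t x y (((n - 1 - j : ℕ) : ℤ) - n) =
      gaussBinom t (n + n) (n + (j + 1)) * (t ^ ((j + 1).choose 2) * y ^ (j + 1)) := by
    intro j hj
    have hj := Finset.mem_range.1 hj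
    rw [gaussBinom_symm _ _ (n + (j + 1)) (by omega), ← thetaTerm_neg x y]
    congr 2
    omega
  have h2 : ∀ j ∈ Finset.range n, gaussBinom t (n + n) (n + (j + 1)) *
      thetaTerm t x y (((n + (j + 1) : ℕ) : ℤ) - n) =
      gaussBinom t (n + n) (n + (j + 1)) * (t ^ ((j + 1).choose 2) * x ^ (j + 1)) := by
    intro j _
    rw [← thetaTerm_ofNat x y]
    congr 2
    push_cast
    ring
  have h3 : thetaTerm t x y (((n + 0 : ℕ) : ℤ) - n) = 1 := by
    simp [thetaTerm]
  rw [Finset.sum_congr rfl h1, Finset.sum_congr rfl h2, h3, mul_one, add_zero, add_comm, add_right_comm,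
    add_comm, ← Finset.sum_add_distrib]
  congr 1
  refine Finset.sum_congr rfl fun j _ => ?_
  ring

end Algebra

/-! ### Limits of the products and zeros of the theta series. -/

section Real

variable {t : ℝ}

lemma one_sub_pow_succ_pos (h0 : 0 ≤ t) (h1 : t < 1) (n : ℕ) : 0 < 1 - t ^ (n + 1) :=
  sub_pos.2 (pow_lt_one₀ h0 h1 n.succ_ne_zero)

lemma qPochhammer_pos (h0 : 0 ≤ t) (h1 : t < 1) (n : ℕ) : 0 < qPochhammer t n :=
  Finset.prod_pos fun _ _ => one_sub_pow_succ_pos h0 h1 _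

lemma qPochhammer_le_one (h0 : 0 ≤ t) (h1 : t < 1) (n : ℕ) : qPochhammer t n ≤ 1 :=
  Finset.prod_le_one (fun _ _ => (one_sub_pow_succ_pos h0 h1 _).le)
    fun _ _ => sub_le_self _ (pow_nonneg h0 _)

lemma antitone_qPochhammer (h0 : 0 ≤ t) (h1 : t < 1) : Antitone (qPochhammer t) :=
  antitone_nat_of_succ_le fun n => by
    rw [qPochhammer_succ]
    exact mul_le_of_le_one_right (qPochhammer_pos h0 h1 n).le (sub_le_self _ (pow_nonneg h0 _))

lemma summable_norm_pow_mul (h0 : 0 ≤ t) (h1 : t < 1) (x : ℂ) :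
    Summable fun i : ℕ => ‖(t : ℂ) ^ i * x‖ := by
  simp only [norm_mul, norm_pow, Complex.norm_real, Real.norm_of_nonneg h0]
  exact (summable_geometric_of_lt_one h0 h1).mul_right _

lemma tendsto_prod_one_add (h0 : 0 ≤ t) (h1 : t < 1) (x : ℂ)
    (hx : ∀ i : ℕ, 1 + (t : ℂ) ^ i * x ≠ 0) :
    ∃ l : ℂ, l ≠ 0 ∧
      Tendsto (fun n => ∏ i ∈ Finset.range n, (1 + (t : ℂ) ^ i * x)) atTop (𝓝 l) :=
  ⟨_, tprod_one_add_ne_zero_of_summable hx (summable_norm_pow_mul h0 h1 x),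
    (multipliable_one_add_of_summable (summable_norm_pow_mul h0 h1 x)).tendsto_prod_tprod_nat⟩

lemma tendsto_qPochhammer (h0 : 0 ≤ t) (h1 : t < 1) :
    ∃ l : ℝ, 0 < l ∧ (∀ n, l ≤ qPochhammer t n) ∧ Tendsto (qPochhammer t) atTop (𝓝 l) := by
  have hs : Summable fun i : ℕ => ‖-t ^ (i + 1)‖ := by
    simp only [norm_neg, norm_pow, Real.norm_of_nonneg h0]
    exact (summable_nat_add_iff 1).2 (summable_geometric_of_lt_one h0 h1)
  have hne : ∀ i : ℕ, 1 + -t ^ (i + 1) ≠ 0 := fun i => (one_sub_pow_succ_pos h0 h1 i).ne'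
  have hl := (multipliable_one_add_of_summable hs).tendsto_prod_tprod_nat
  have hl' : Tendsto (qPochhammer t) atTop (𝓝 (∏' i : ℕ, (1 + -t ^ (i + 1)))) := hl
  have hle : ∀ n, ∏' i : ℕ, (1 + -t ^ (i + 1)) ≤ qPochhammer t n :=
    (antitone_qPochhammer h0 h1).le_of_tendsto hl'
  refine ⟨_, lt_of_le_of_ne ?_ (tprod_one_add_ne_zero_of_summable hne hs).symm, hle, hl'⟩
  exact ge_of_tendsto' hl' fun n => (qPochhammer_pos h0 h1 n).le

lemma summable_pow_choose_two (h0 : 0 ≤ t) (h1 : t < 1) (c : ℝ) :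
    Summable fun n : ℕ => t ^ (n.choose 2) * c ^ n := by
  rcases eq_or_ne c 0 with rfl | hc
  · refine summable_of_ne_finset_zero (s := {0}) fun n hn => ?_
    rw [zero_pow (by simpa using hn), mul_zero]
  rcases h0.eq_or_lt with rfl | h0
  · refine summable_of_ne_finset_zero (s := {0, 1}) fun n hn => ?_
    have : n.choose 2 ≠ 0 := by
      rw [Nat.choose_ne_zero_iff]
      simp at hn
      omega
    rw [zero_pow this, zero_mul]
  refine summable_of_ratio_test_tendsto_lt_one (l := 0) one_pos
    (Eventually.of_forall fun n => mul_ne_zero (pow_ne_zero _ h0.ne') (pow_ne_zero _ hc)) ?_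
  have : ∀ n : ℕ, ‖t ^ ((n + 1).choose 2) * c ^ (n + 1)‖ / ‖t ^ (n.choose 2) * c ^ n‖ =
      t ^ n * |c| := by
    intro n
    have hc' : |c| ≠ 0 := abs_ne_zero.2 hc
    rw [succ_choose_two, norm_mul, norm_mul, norm_pow, norm_pow, norm_pow, norm_pow,
      Real.norm_of_nonneg h0.le, Real.norm_eq_abs]
    field_simp
    ring
  simp only [this]
  simpa using (tendsto_pow_atTop_nhds_zero_of_lt_one h0.le h1).mul_const |c|

end Real

/-- The symmetric theta series with `x * y = t` vanishes only where a factor of its product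
expansion does. -/
lemma exists_of_one_add_tsum_eq_zero {t : ℝ} (h0 : 0 ≤ t) (h1 : t < 1) {x y : ℂ}
    (hxy : x * y = t)
    (h : 1 + ∑' j : ℕ, (t : ℂ) ^ ((j + 1).choose 2) * (x ^ (j + 1) + y ^ (j + 1)) = 0) :
    ∃ i : ℕ, 1 + (t : ℂ) ^ i * x = 0 ∨ 1 + (t : ℂ) ^ i * y = 0 := by
  by_contra! hcon
  obtain ⟨lx, hlx, hx⟩ := tendsto_prod_one_add h0 h1 x fun i => (hcon i).1
  obtain ⟨ly, hly, hy⟩ := tendsto_prod_one_add h0 h1 y fun i => (hcon i).2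
  obtain ⟨l, hl, hle, hlt⟩ := tendsto_qPochhammer h0 h1
  have ht : ∀ n : ℕ, 1 - (t : ℂ) ^ (n + 1) ≠ 0 := fun n => by
    have := (one_sub_pow_succ_pos h0 h1 n).ne'
    exact_mod_cast this
  have hcast : ∀ n, qPochhammer (t : ℂ) n = (qPochhammer t n : ℝ) := fun n => by
    simp [qPochhammer]
  have hnorm : ∀ n, ‖qPochhammer (t : ℂ) n‖ = qPochhammer t n := fun n => by
    rw [hcast, Complex.norm_real, Real.norm_of_nonneg (qPochhammer_pos h0 h1 n).le]
  have hltC : Tendsto (qPochhammer (t : ℂ)) atTop (𝓝 (l : ℂ)) := by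
    have := (Complex.continuous_ofReal.tendsto l).comp hlt
    exact this.congr fun n => (hcast n).symm
  have hlC : (l : ℂ) ≠ 0 := by exact_mod_cast hl.ne'
  -- With l = (t; t)_∞ the central coefficients tend to l / l² = 1 / l, and all of them are bounded
  -- by 1 / l², which permits dominated convergence.
  have hG : ∀ k, Tendsto (fun n => gaussBinom (t : ℂ) (n + n) (n + k)) atTop (𝓝 ((l : ℂ)⁻¹)) := by
    intro k
    have e : (fun n => qPochhammer (t : ℂ) (n + n) / (qPochhammer (t : ℂ) (n + k) *
        qPochhammer (t : ℂ) (n - k))) =ᶠ[atTop]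
        fun n => gaussBinom (t : ℂ) (n + n) (n + k) := by
      filter_upwards [eventually_ge_atTop k] with n hn
      rw [gaussBinom, if_pos (by omega), show n + n - (n + k) = n - k by omega]
    refine Tendsto.congr' e ?_
    have a1 : Tendsto (fun n : ℕ => n + n) atTop atTop := 
      tendsto_atTop_mono (fun n => Nat.le_add_left n n) tendsto_id
    have := (hltC.comp a1).div ((hltC.comp (tendsto_add_atTop_nat k)).mul
      (hltC.comp (tendsto_sub_atTop_nat k))) (mul_ne_zero hlC hlC)
    rw [show (l : ℂ)⁻¹ = l / (l * l) by field_simp]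
    exact this
  have hGb : ∀ N k, ‖gaussBinom (t : ℂ) N k‖ ≤ (l * l)⁻¹ := by
    intro N k
    rw [gaussBinom]
    split_ifs
    · rw [norm_div, norm_mul, hnorm, hnorm, hnorm, ← one_div]
      exact div_le_div₀ zero_le_one (qPochhammer_le_one h0 h1 _) (by positivity)
        (mul_le_mul (hle _) (hle _) hl.le (qPochhammer_pos h0 h1 _).le)
    · rw [norm_zero]; positivity
  have hbs : Summable fun j : ℕ => (l * l)⁻¹ * (t ^ ((j + 1).choose 2) * ‖x‖ ^ (j + 1) +
      t ^ ((j + 1).choose 2) * ‖y‖ ^ (j + 1)) :=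
    (((summable_nat_add_iff 1).2 (summable_pow_choose_two h0 h1 ‖x‖)).add
      ((summable_nat_add_iff 1).2 (summable_pow_choose_two h0 h1 ‖y‖))).mul_left _
  have hlim := tendsto_tsum_of_dominated_convergence hbs
    (f := fun n j => gaussBinom (t : ℂ) (n + n) (n + (j + 1)) *
      ((t : ℂ) ^ ((j + 1).choose 2) * (x ^ (j + 1) + y ^ (j + 1))))
    (fun j => (hG (j + 1)).mul_const _) (Eventually.of_forall fun n j => by
      rw [norm_mul]
      refine mul_le_mul (hGb _ _) ?_ (norm_nonneg _) (by positivity)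
      rw [norm_mul, ← mul_add, norm_pow, Complex.norm_real, Real.norm_of_nonneg h0]
      gcongr
      exact (norm_add_le _ _).trans (by rw [norm_pow, norm_pow]))
  have hprod := (hx.mul hy).congr fun n => prod_eq_gaussBinom_add_sum ht hxy n
  have hsum : ∀ n, ∑' j : ℕ, gaussBinom (t : ℂ) (n + n) (n + (j + 1)) *
      ((t : ℂ) ^ ((j + 1).choose 2) * (x ^ (j + 1) + y ^ (j + 1))) =
      ∑ j ∈ Finset.range n, gaussBinom (t : ℂ) (n + n) (n + (j + 1)) *
        ((t : ℂ) ^ ((j + 1).choose 2) * (x ^ (j + 1) + y ^ (j + 1))) := fun n =>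
    tsum_eq_sum fun j hj => by
      rw [gaussBinom_of_lt (by simp at hj; omega), zero_mul]
  have hlim2 := (hG 0).add (hlim.congr hsum)
  have := tendsto_nhds_unique hprod hlim2
  rw [tsum_mul_left, ← mul_one_add, h, mul_zero] at this
  exact mul_ne_zero hlx hly this

/-! ### Simplicity of the zero -1 of the theta series. -/

/-- Bounds the tail of the alternating series below: 4 (2/5)^6 < 1/50, and each further step costs
at most 2 (2/5)^4 < 1/10. -/
lemma mul_pow_choose_two_le {t : ℝ} (h0 : 0 ≤ t) (h1 : t ≤ 2 / 5) (k : ℕ) :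
    ((k + 4 : ℕ) : ℝ) * t ^ ((k + 4).choose 2) ≤ 1 / 50 * (1 / 10) ^ k := by
  induction k with
  | zero =>
    have : t ^ 6 ≤ (2 / 5) ^ 6 := pow_le_pow_left₀ h0 h1 6
    norm_num [Nat.choose] at this ⊢
    linarith
  | succ k ih =>
    rw [show k + 1 + 4 = k + 4 + 1 by ring, succ_choose_two (k + 4), pow_succ]
    have h4 : t ^ (k + 4) ≤ (2 / 5) ^ 4 :=
      (pow_le_pow_of_le_one h0 (by linarith) (by omega : 4 ≤ k + 4)).trans
        (pow_le_pow_left₀ h0 h1 4)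
    have hk : ((k + 4 + 1 : ℕ) : ℝ) ≤ 2 * ((k + 4 : ℕ) : ℝ) := by push_cast; linarith
    calc ((k + 4 + 1 : ℕ) : ℝ) * t ^ (k + 4 + (k + 4).choose 2)
        ≤ 2 * ((k + 4 : ℕ) : ℝ) * ((2 / 5) ^ 4 * t ^ ((k + 4).choose 2)) := by
          rw [pow_add]; gcongr
      _ = 2 * (2 / 5) ^ 4 * (((k + 4 : ℕ) : ℝ) * t ^ ((k + 4).choose 2)) := by ring
      _ ≤ 1 / 10 * (1 / 50 * (1 / 10) ^ k) := by
          gcongr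
          norm_num
      _ = _ := by ring

/-- The derivative of the theta series at its zero `-1` does not vanish. -/
lemma tsum_alternating_theta_pos {t : ℝ} (h0 : 0 ≤ t) (h1 : t ≤ 2 / 5) :
    0 < ∑' j : ℕ, (t ^ ((j + 1).choose 2) - t ^ (j + 1) * t ^ ((j + 1).choose 2)) *
      (((j + 1 : ℕ) : ℝ) * (-1) ^ j) := by
  set c : ℕ → ℝ := fun j => (t ^ ((j + 1).choose 2) - t ^ (j + 1) * t ^ ((j + 1).choose 2)) *
      (((j + 1 : ℕ) : ℝ) * (-1) ^ j) with hc
  have hb : ∀ k, ‖c (k + 3)‖ ≤ 1 / 50 * (1 / 10) ^ k := by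
    intro k
    refine le_trans ?_ (mul_pow_choose_two_le h0 h1 k)
    have hp : t ^ (k + 4) ≤ 1 := pow_le_one₀ h0 (by linarith)
    have hp' : 0 ≤ t ^ (k + 4) := pow_nonneg h0 _
    simp only [hc, norm_mul, norm_pow, norm_neg, norm_one, one_pow, mul_one, Real.norm_natCast,
      show k + 3 + 1 = k + 4 by ring]
    rw [mul_comm]
    refine mul_le_mul_of_nonneg_left ?_ (Nat.cast_nonneg _)
    rw [← one_sub_mul, norm_mul, Real.norm_of_nonneg (sub_nonneg.2 hp),
      Real.norm_of_nonneg (pow_nonneg h0 _)]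
    exact mul_le_of_le_one_left (pow_nonneg h0 _) (by linarith)
  have hg : HasSum (fun k : ℕ => (1 / 50 : ℝ) * (1 / 10) ^ k) (1 / 45) := by
    have := (hasSum_geometric_of_lt_one (r := (1 / 10 : ℝ)) (by norm_num) (by norm_num)).mul_left
      (1 / 50)
    rwa [show (1 / 50 : ℝ) * (1 - 1 / 10)⁻¹ = 1 / 45 by norm_num] at this
  have hs3 : Summable fun k => c (k + 3) := Summable.of_norm_bounded hg.summable hb
  have hs : Summable c := (summable_nat_add_iff 3).1 hs3
  have htail : ‖∑' k, c (k + 3)‖ ≤ 1 / 45 := tsum_of_norm_bounded hg hb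
  rw [← hs.sum_add_tsum_nat_add 3]
  -- The three terms add up to 1 - 3t + 5t³ - 3t⁶, which decreases on [0, 2/5] to about 0.108; this
  -- exceeds the tail bound 1/45.
  have h3 : 1 / 10 ≤ ∑ i ∈ Finset.range 3, c i := by
    simp only [hc, Finset.sum_range_succ, Finset.sum_range_zero]
    norm_num [Nat.choose]
    nlinarith [mul_nonneg h0 h0, mul_nonneg (mul_nonneg h0 h0) h0, pow_le_pow_left₀ h0 h1 2,
      pow_le_pow_left₀ h0 h1 3, pow_le_pow_left₀ h0 h1 6, mul_nonneg h0 (sub_nonneg.2 h1)]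
  have := (abs_le.1 htail).1
  linarith

/-! ### Conjugate divided differences and the limiting contradiction. -/

/-- The divided difference of `z ↦ z ^ n` at `u` and its conjugate. -/
noncomputable def conjDivDiff (n : ℕ) (u : ℂ) : ℂ :=
  ∑ i ∈ Finset.range n, u ^ i * (starRingEnd ℂ u) ^ (n - 1 - i)

lemma conjDivDiff_mul_sub (n : ℕ) (u : ℂ) :
    conjDivDiff n u * (u - starRingEnd ℂ u) = u ^ n - (starRingEnd ℂ u) ^ n :=
  geom_sum₂_mul _ _ _

lemma conjDivDiff_of_conj_eq {u : ℂ} (hu : starRingEnd ℂ u = u) (n : ℕ) :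
    conjDivDiff n u = n * u ^ (n - 1) := by
  rw [conjDivDiff, hu, geom_sum₂_self]

lemma norm_conjDivDiff_le {u : ℂ} (hu : ‖u‖ = 1) (n : ℕ) : ‖conjDivDiff n u‖ ≤ n := by
  refine (norm_sum_le _ _).trans ?_
  simp [hu]

lemma continuous_conjDivDiff (n : ℕ) : Continuous (conjDivDiff n) := by
  unfold conjDivDiff
  fun_prop

lemma summable_pow_choose_two_succ {t : ℝ} (h0 : 0 ≤ t) (h1 : t < 1) :
    Summable fun j : ℕ => t ^ ((j + 1).choose 2) * ((j + 1 : ℕ) : ℝ) := by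
  refine Summable.of_nonneg_of_le (fun j => by positivity) (fun j => ?_)
    ((summable_nat_add_iff 1).2 (summable_pow_choose_two h0 h1 2))
  have : ((j + 1 : ℕ) : ℝ) ≤ 2 ^ (j + 1) := by exact_mod_cast Nat.lt_two_pow_self.le
  gcongr

/-- Taking moduli gives t^i α = 1 with both factors at most 1, so both equal 1. -/
lemma eq_neg_one_of_one_add_pow_mul_eq_zero {t α : ℝ} (h0 : 0 ≤ t) (h1 : t < 1) (hα : 0 ≤ α)
    (hα1 : α ≤ 1) {u : ℂ} (hu : ‖u‖ = 1) {i : ℕ} (h : 1 + (t : ℂ) ^ i * (α * u) = 0) :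
    α = 1 ∧ u = -1 := by
  have h2 : (t : ℂ) ^ i * (α * u) = -1 := by linear_combination h
  have h3 := congrArg norm h2
  rw [norm_mul, norm_mul, norm_pow, Complex.norm_real, Complex.norm_real, norm_neg, norm_one, hu,
    Real.norm_of_nonneg h0, Real.norm_of_nonneg hα, mul_one] at h3
  have h4 : t ^ i ≤ 1 := pow_le_one₀ h0 h1.le
  have h5 : 0 ≤ t ^ i := pow_nonneg h0 i
  have h6 : α = 1 := by nlinarith
  have h7 : t ^ i = 1 := by rw [h6, mul_one] at h3; exact h3
  refine ⟨h6, ?_⟩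
  have h8 : (t : ℂ) ^ i = 1 := by exact_mod_cast h7
  rw [h8, h6] at h2
  simpa using h2

/-- Two-sided coefficient families converging to theta coefficients cannot all have a common zero
of the Laurent series and of its conjugate divided difference. -/
lemma false_of_tendsto_theta {ι : Type*} {l : Filter ι} [l.NeBot] {B C : ι → ℕ → ℝ} {u : ι → ℂ}
    {α β t : ℝ} {u₀ : ℂ} (hα : 0 ≤ α) (hα1 : α ≤ 1) (hβ : 0 ≤ β) (hβ1 : β ≤ 1) (hαβ : α * β = t)
    (ht : t ≤ 2 / 5) (hu : ∀ m, ‖u m‖ = 1) (hu₀ : Tendsto u l (𝓝 u₀))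
    (hBb : ∀ m n, |B m n| ≤ (2 / 5 : ℝ) ^ (n.choose 2))
    (hCb : ∀ m n, |C m n| ≤ (2 / 5 : ℝ) ^ (n.choose 2))
    (hB : ∀ n, Tendsto (B · n) l (𝓝 (α ^ n * t ^ (n.choose 2))))
    (hC : ∀ n, Tendsto (C · n) l (𝓝 (β ^ n * t ^ (n.choose 2))))
    (hF : ∀ m, 1 + ∑' j : ℕ, ((B m (j + 1) : ℂ) * u m ^ (j + 1) +
      C m (j + 1) * (starRingEnd ℂ (u m)) ^ (j + 1)) = 0)
    (hW : ∀ m, ∑' j : ℕ, ((B m (j + 1) : ℂ) - C m (j + 1)) * conjDivDiff (j + 1) (u m) = 0) :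
    False := by
  have h0 : 0 ≤ t := hαβ ▸ mul_nonneg hα hβ
  have h1 : t < 1 := by linarith
  have hu₀n : ‖u₀‖ = 1 :=
    tendsto_nhds_unique (hu₀.norm) (by simp only [hu]; exact tendsto_const_nhds)
  -- One majorant serves both series; the factor j + 1 is needed only for the divided differences.
  have hsum : Summable fun j : ℕ => (2 : ℝ) * ((2 / 5 : ℝ) ^ ((j + 1).choose 2) *
      ((j + 1 : ℕ) : ℝ)) :=
    (summable_pow_choose_two_succ (by norm_num) (by norm_num)).mul_left 2
  have hBc : ∀ n, Tendsto (fun m => (B m n : ℂ)) l (𝓝 ((α ^ n * t ^ (n.choose 2) : ℝ) : ℂ)) :=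
    fun n => (Complex.continuous_ofReal.tendsto _).comp (hB n)
  have hCc : ∀ n, Tendsto (fun m => (C m n : ℂ)) l (𝓝 ((β ^ n * t ^ (n.choose 2) : ℝ) : ℂ)) :=
    fun n => (Complex.continuous_ofReal.tendsto _).comp (hC n)
  have hstar : Tendsto (fun m => starRingEnd ℂ (u m)) l (𝓝 (starRingEnd ℂ u₀)) :=
    (Complex.continuous_conj.tendsto _).comp hu₀
  have hlimF := tendsto_tsum_of_dominated_convergence hsum
    (f := fun m j => (B m (j + 1) : ℂ) * u m ^ (j + 1) +
      C m (j + 1) * (starRingEnd ℂ (u m)) ^ (j + 1))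
    (fun j => ((hBc (j + 1)).mul (hu₀.pow (j + 1))).add ((hCc (j + 1)).mul (hstar.pow (j + 1))))
    (Eventually.of_forall fun m j => by
      refine (norm_add_le _ _).trans ?_
      rw [norm_mul, norm_mul, norm_pow, norm_pow, RCLike.norm_conj, hu, one_pow, mul_one, mul_one,
        Complex.norm_real, Complex.norm_real, Real.norm_eq_abs, Real.norm_eq_abs]
      have a1 := hBb m (j + 1)
      have a2 := hCb m (j + 1)
      have a3 : (2 / 5 : ℝ) ^ ((j + 1).choose 2) * 1 ≤
        (2 / 5 : ℝ) ^ ((j + 1).choose 2) * ((j + 1 : ℕ) : ℝ) := by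
        gcongr
        push_cast
        linarith [(Nat.cast_nonneg j : (0 : ℝ) ≤ j)]
      linarith)
  have hlimW := tendsto_tsum_of_dominated_convergence hsum
    (f := fun m j => ((B m (j + 1) : ℂ) - C m (j + 1)) * conjDivDiff (j + 1) (u m))
    (fun j => ((hBc (j + 1)).sub (hCc (j + 1))).mul
      (((continuous_conjDivDiff (j + 1)).tendsto _).comp hu₀))
    (Eventually.of_forall fun m j => by
      rw [norm_mul, ← mul_assoc]
      refine mul_le_mul ?_ (norm_conjDivDiff_le (hu m) _) (norm_nonneg _) (by positivity)
      refine (norm_sub_le _ _).trans ?_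
      rw [Complex.norm_real, Complex.norm_real, Real.norm_eq_abs, Real.norm_eq_abs]
      linarith [hBb m (j + 1), hCb m (j + 1)])
  simp only [hW] at hlimW
  have hW0 := tendsto_nhds_unique hlimW tendsto_const_nhds
  have hlimF' := hlimF.const_add 1
  simp only [hF] at hlimF'
  have hF0 := tendsto_nhds_unique hlimF' tendsto_const_nhds
  have huu : u₀ * starRingEnd ℂ u₀ = 1 := by
    rw [Complex.mul_conj, Complex.normSq_eq_norm_sq, hu₀n]; simp
  have hxy : (α * u₀) * (β * starRingEnd ℂ u₀) = (t : ℂ) := by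
    rw [← hαβ]
    push_cast
    linear_combination (α * β : ℂ) * huu
  obtain ⟨i, hi⟩ := exists_of_one_add_tsum_eq_zero h0 h1 hxy (by
    rw [← hF0]
    congr 1
    refine tsum_congr fun j => ?_
    push_cast
    ring)
  have hpos := tsum_alternating_theta_pos h0 ht
  set c : ℕ → ℝ := fun j => (t ^ ((j + 1).choose 2) - t ^ (j + 1) * t ^ ((j + 1).choose 2)) *
      (((j + 1 : ℕ) : ℝ) * (-1) ^ j) with hc
  have hV : ∀ j, conjDivDiff (j + 1) (-1) = ((j + 1 : ℕ) : ℂ) * (-1) ^ j := fun j =>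
    conjDivDiff_of_conj_eq (by simp) _
  rcases hi with hi | hi
  · obtain ⟨rfl, rfl⟩ := eq_neg_one_of_one_add_pow_mul_eq_zero h0 h1 hα hα1 hu₀n hi
    have hβt : β = t := by linarith
    have : ((∑' j, c j : ℝ) : ℂ) = 0 := by
      rw [← hW0, Complex.ofReal_tsum]
      refine tsum_congr fun j => ?_
      rw [hV, hc, hβt]
      push_cast
      ring
    exact hpos.ne' (by exact_mod_cast this)
  · obtain ⟨rfl, hu1⟩ := eq_neg_one_of_one_add_pow_mul_eq_zero h0 h1 hβ hβ1
      ((RCLike.norm_conj u₀).trans hu₀n) hi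
    have hu1 : u₀ = -1 := by simpa using congrArg (starRingEnd ℂ) hu1
    -- The roles of the two sides are exchanged, so the limit of the second equation is the same
    -- series with opposite sign.
    have hαt : α = t := by linarith
    have : ((∑' j, c j : ℝ) : ℂ) = 0 := by
      rw [← neg_eq_zero, ← hW0, Complex.ofReal_tsum, ← tsum_neg]
      refine tsum_congr fun j => ?_
      rw [hu1, hV, hc, hαt]
      push_cast
      ring
    exact hpos.ne' (by exact_mod_cast this)

/-! ### Bounds and limits of the coefficients relative to one term. -/

section Coefficients

variable {a : ℕ → ℝ}

/-- The coefficients above the index `ν`, relative to the `ν`-th one, on the circle of radius `r`. -/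
noncomputable def upperCoeff (a : ℕ → ℝ) (ν : ℕ) (r : ℝ) (n : ℕ) : ℝ :=
  a (ν + n) * r ^ n / a ν

/-- The coefficients below the index `ν`, relative to the `ν`-th one, on the circle of radius `r`. -/
noncomputable def lowerCoeff (a : ℕ → ℝ) (ν : ℕ) (r : ℝ) (n : ℕ) : ℝ :=
  if n ≤ ν then a (ν - n) / (r ^ n * a ν) else 0

/-- The ratio of consecutive coefficients. -/
noncomputable def coeffRatio (a : ℕ → ℝ) (k : ℕ) : ℝ := a k / a (k + 1)

lemma coeffRatio_pos (ha : ∀ k, 0 < a k) (k : ℕ) : 0 < coeffRatio a k := div_pos (ha _) (ha _)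

lemma inv_secondQuotient (ha : ∀ k, 0 < a k) (k : ℕ) :
    (secondQuotient a (k + 2))⁻¹ = coeffRatio a k / coeffRatio a (k + 1) := by
  have h0 := (ha k).ne'
  have h1 := (ha (k + 1)).ne'
  have h2 := (ha (k + 2)).ne'
  simp only [secondQuotient, coeffRatio, show k + 2 - 1 = k + 1 by omega,
    show k + 2 - 2 = k by omega]
  field_simp

lemma upperCoeff_zero (ha : ∀ k, 0 < a k) (ν : ℕ) (r : ℝ) : upperCoeff a ν r 0 = 1 := by
  simp [upperCoeff, (ha ν).ne']

lemma lowerCoeff_zero (ha : ∀ k, 0 < a k) (ν : ℕ) (r : ℝ) : lowerCoeff a ν r 0 = 1 := by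
  simp [lowerCoeff, (ha ν).ne']

lemma upperCoeff_succ (ha : ∀ k, 0 < a k) (ν : ℕ) (r : ℝ) (n : ℕ) :
    upperCoeff a ν r (n + 1) = upperCoeff a ν r n * (r / coeffRatio a (ν + n)) := by
  have h0 := (ha (ν + n)).ne'
  have h1 := (ha (ν + n + 1)).ne'
  have h2 := (ha ν).ne'
  rw [upperCoeff, upperCoeff, coeffRatio, ← add_assoc]
  field_simp
  ring

lemma lowerCoeff_succ (ha : ∀ k, 0 < a k) (v : ℕ) {r : ℝ} (hr : 0 < r) {n : ℕ} (hn : n ≤ v) :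
    lowerCoeff a (v + 1) r (n + 1) = lowerCoeff a (v + 1) r n * (coeffRatio a (v - n) / r) := by
  rw [lowerCoeff, lowerCoeff, if_pos (by omega), if_pos (by omega), coeffRatio,
    show v + 1 - (n + 1) = v - n by omega, show v + 1 - n = v - n + 1 by omega]
  have h1 := (ha (v - n + 1)).ne'
  have h2 := (ha (v + 1)).ne'
  field_simp
  ring

lemma div_coeffRatio_le {T : ℝ} (ha : ∀ k, 0 < a k) (hT0 : 0 ≤ T)
    (hT : ∀ k, coeffRatio a k / coeffRatio a (k + 1) ≤ T) {ν : ℕ} {r : ℝ} (hr0 : 0 < r)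
    (hr : r ≤ coeffRatio a ν) (n : ℕ) : r / coeffRatio a (ν + n) ≤ T ^ n := by
  induction n with
  | zero => simpa using (div_le_one (coeffRatio_pos ha ν)).2 hr
  | succ n ih =>
    have h1 := coeffRatio_pos ha (ν + n)
    have h2 := coeffRatio_pos ha (ν + n + 1)
    calc r / coeffRatio a (ν + (n + 1))
        = r / coeffRatio a (ν + n) * (coeffRatio a (ν + n) / coeffRatio a (ν + n + 1)) := by
          rw [← add_assoc]; field_simp
      _ ≤ T ^ n * T := mul_le_mul ih (hT _) (by positivity) (by positivity)
      _ = T ^ (n + 1) := (pow_succ _ _).symm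

lemma coeffRatio_div_le {T : ℝ} (ha : ∀ k, 0 < a k) (hT0 : 0 ≤ T)
    (hT : ∀ k, coeffRatio a k / coeffRatio a (k + 1) ≤ T) {v : ℕ} {r : ℝ} (hr0 : 0 < r)
    (hr : coeffRatio a v ≤ r) {n : ℕ} (hn : n ≤ v) : coeffRatio a (v - n) / r ≤ T ^ n := by
  induction n with
  | zero => simpa using (div_le_one hr0).2 hr
  | succ n ih =>
    obtain ⟨j, rfl⟩ := Nat.exists_eq_add_of_le' hn
    have ih := ih (by omega)
    rw [show j + (n + 1) - n = j + 1 by omega] at ih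
    rw [show j + (n + 1) - (n + 1) = j by omega]
    have h1 := coeffRatio_pos ha j
    have h2 := coeffRatio_pos ha (j + 1)
    calc coeffRatio a j / r
        = coeffRatio a (j + 1) / r * (coeffRatio a j / coeffRatio a (j + 1)) := by field_simp
      _ ≤ T ^ n * T := mul_le_mul ih (hT _) (by positivity) (by positivity)
      _ = T ^ (n + 1) := (pow_succ _ _).symm

lemma upperCoeff_nonneg (ha : ∀ k, 0 < a k) (ν : ℕ) {r : ℝ} (hr : 0 < r) (n : ℕ) :
    0 ≤ upperCoeff a ν r n := by
  have h1 := ha ν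
  have h2 := ha (ν + n)
  unfold upperCoeff
  positivity

lemma lowerCoeff_nonneg (ha : ∀ k, 0 < a k) (ν : ℕ) {r : ℝ} (hr : 0 < r) (n : ℕ) :
    0 ≤ lowerCoeff a ν r n := by
  have h1 := ha ν
  have h2 := ha (ν - n)
  unfold lowerCoeff
  split_ifs <;> positivity

/-- The coefficient is the product of r / ρ_{ν+i} ≤ T^i over i < n, and these exponents add up to n
choose 2. -/
lemma upperCoeff_le {T : ℝ} (ha : ∀ k, 0 < a k) (hT0 : 0 ≤ T)
    (hT : ∀ k, coeffRatio a k / coeffRatio a (k + 1) ≤ T) {ν : ℕ} {r : ℝ} (hr0 : 0 < r)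
    (hr : r ≤ coeffRatio a ν) (n : ℕ) : upperCoeff a ν r n ≤ T ^ (n.choose 2) := by
  induction n with
  | zero => simp [upperCoeff_zero ha]
  | succ n ih =>
    rw [upperCoeff_succ ha, succ_choose_two, add_comm n, pow_add]
    have := coeffRatio_pos ha (ν + n)
    exact mul_le_mul ih (div_coeffRatio_le ha hT0 hT hr0 hr n) (by positivity) (by positivity)

lemma lowerCoeff_le {T : ℝ} (ha : ∀ k, 0 < a k) (hT0 : 0 ≤ T)
    (hT : ∀ k, coeffRatio a k / coeffRatio a (k + 1) ≤ T) {v : ℕ} {r : ℝ} (hr0 : 0 < r)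
    (hr : coeffRatio a v ≤ r) (n : ℕ) : lowerCoeff a (v + 1) r n ≤ T ^ (n.choose 2) := by
  induction n with
  | zero => simp [lowerCoeff_zero ha]
  | succ n ih =>
    by_cases hn : n ≤ v
    · rw [lowerCoeff_succ ha v hr0 hn, succ_choose_two, add_comm n, pow_add]
      have := coeffRatio_pos ha (v - n)
      exact mul_le_mul ih (coeffRatio_div_le ha hT0 hT hr0 hr hn) (by positivity) (by positivity)
    · rw [lowerCoeff, if_neg (by omega)]
      positivity

variable {ι : Type*} {l : Filter ι} {v : ι → ℕ} {r : ι → ℝ} {t : ℝ}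

lemma tendsto_upperCoeff (ha : ∀ k, 0 < a k)
    (ht : Tendsto (fun k => coeffRatio a k / coeffRatio a (k + 1)) atTop (𝓝 t))
    (hv : Tendsto v l atTop) {α : ℝ}
    (hα : Tendsto (fun m => r m / coeffRatio a (v m)) l (𝓝 α)) (n : ℕ) :
    Tendsto (fun m => upperCoeff a (v m) (r m) n) l (𝓝 (α ^ n * t ^ (n.choose 2))) := by
  have key : ∀ n, Tendsto (fun m => r m / coeffRatio a (v m + n)) l (𝓝 (α * t ^ n)) := by
    intro n
    induction n with
    | zero => simpa using hα
    | succ n ih =>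
      have := ih.mul (ht.comp ((tendsto_add_atTop_nat n).comp hv))
      rw [mul_assoc, ← pow_succ] at this
      refine this.congr fun m => ?_
      have h1 := coeffRatio_pos ha (v m + n)
      have h2 := coeffRatio_pos ha (v m + n + 1)
      simp only [Function.comp, ← add_assoc]
      field_simp
  induction n with
  | zero => simpa [upperCoeff_zero ha] using tendsto_const_nhds
  | succ n ih =>
    have := ih.mul (key n)
    rw [succ_choose_two, pow_succ, show α ^ n * α * t ^ (n + n.choose 2) =
      α ^ n * t ^ n.choose 2 * (α * t ^ n) by ring]
    exact this.congr fun m => (upperCoeff_succ ha _ _ _).symm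

/-- The cutoff in `lowerCoeff` and the truncated subtraction do not matter in the limit, since v → ∞
while n is fixed. -/
lemma tendsto_lowerCoeff (ha : ∀ k, 0 < a k)
    (ht : Tendsto (fun k => coeffRatio a k / coeffRatio a (k + 1)) atTop (𝓝 t))
    (hv : Tendsto v l atTop) (hr : ∀ m, 0 < r m) {β : ℝ}
    (hβ : Tendsto (fun m => coeffRatio a (v m) / r m) l (𝓝 β)) (n : ℕ) :
    Tendsto (fun m => lowerCoeff a (v m + 1) (r m) n) l (𝓝 (β ^ n * t ^ (n.choose 2))) := by
  have key : ∀ n, Tendsto (fun m => coeffRatio a (v m - n) / r m) l (𝓝 (β * t ^ n)) := by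
    intro n
    induction n with
    | zero => simpa using hβ
    | succ n ih =>
      have := ih.mul (ht.comp ((tendsto_sub_atTop_nat (n + 1)).comp hv))
      rw [mul_assoc, ← pow_succ] at this
      refine this.congr' ?_
      filter_upwards [hv.eventually_ge_atTop (n + 1)] with m hm
      have h1 := coeffRatio_pos ha (v m - n)
      have h2 := hr m
      simp only [Function.comp, show v m - (n + 1) + 1 = v m - n by omega]
      field_simp
  induction n with
  | zero => simpa [lowerCoeff_zero ha] using tendsto_const_nhds
  | succ n ih =>
    have := ih.mul (key n)
    rw [succ_choose_two, pow_succ, show β ^ n * β * t ^ (n + n.choose 2) =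
      β ^ n * t ^ n.choose 2 * (β * t ^ n) by ring]
    refine this.congr' ?_
    filter_upwards [hv.eventually_ge_atTop n] with m hm
    exact (lowerCoeff_succ ha _ (hr m) hm).symm

end Coefficients

/-! ### The equations satisfied at a zero, relative to one term. -/

/-- Summation of a series outwards from the index `ν`. -/
lemma HasSum.recenter {c : ℕ → ℂ} {s : ℂ} (h : HasSum c s) (ν : ℕ) :
    HasSum (fun j => c (ν + (j + 1)) + if j + 1 ≤ ν then c (ν - (j + 1)) else 0) (s - c ν) := by
  have h1 := (hasSum_nat_add_iff' (ν + 1)).2 h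
  have h2 : HasSum (fun j => if j + 1 ≤ ν then c (ν - (j + 1)) else 0)
      (∑ j ∈ Finset.range ν, c j) := by
    rw [← Finset.sum_range_reflect]
    have : HasSum (fun j => if j + 1 ≤ ν then c (ν - (j + 1)) else 0)
        (∑ j ∈ Finset.range ν, if j + 1 ≤ ν then c (ν - (j + 1)) else 0) :=
      hasSum_sum_of_ne_finset_zero fun j hj => if_neg (by simp at hj; omega)
    convert! this using 1
    refine Finset.sum_congr rfl fun j hj => ?_
    rw [if_pos (by simp at hj; omega), show ν - 1 - j = ν - (j + 1) by omega]
  convert! h1.add h2 using 1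
  · funext j
    rw [show j + (ν + 1) = ν + (j + 1) by ring]
  · rw [Finset.sum_range_succ]
    ring

section Zeros

variable {a : ℕ → ℝ} {f : ℂ → ℂ}

lemma upperCoeff_mul_pow (ha : ∀ k, 0 < a k) (ν n : ℕ) (r : ℝ) (u : ℂ) :
    (a (ν + n) : ℂ) * (r * u) ^ (ν + n) =
      (a ν * (r * u) ^ ν) * (upperCoeff a ν r n * u ^ n) := by
  have : (a ν : ℂ) ≠ 0 := by exact_mod_cast (ha ν).ne'
  simp only [upperCoeff]
  push_cast
  field_simp
  ring

lemma lowerCoeff_mul_pow (ha : ∀ k, 0 < a k) {ν n : ℕ} (hn : n ≤ ν) {r : ℝ} (hr : 0 < r) {u : ℂ}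
    (hu : u * starRingEnd ℂ u = 1) :
    (a (ν - n) : ℂ) * (r * u) ^ (ν - n) =
      (a ν * (r * u) ^ ν) * (lowerCoeff a ν r n * (starRingEnd ℂ u) ^ n) := by
  have h1 : (a ν : ℂ) ≠ 0 := by exact_mod_cast (ha ν).ne'
  have h2 : (r : ℂ) ≠ 0 := by exact_mod_cast hr.ne'
  have h3 : u ^ n * (starRingEnd ℂ u) ^ n = 1 := by rw [← mul_pow, hu, one_pow]
  obtain ⟨j, rfl⟩ := Nat.exists_eq_add_of_le' hn
  rw [lowerCoeff, if_pos hn, Nat.add_sub_cancel]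
  push_cast
  field_simp
  linear_combination (-(a j : ℂ) * r ^ n * (r * u) ^ j) * h3

lemma lowerCoeff_of_lt {ν n : ℕ} (hn : ν < n) (r : ℝ) : lowerCoeff a ν r n = 0 :=
  if_neg (by omega)

lemma coeff_mul_pow_ne_zero (ha : ∀ k, 0 < a k) (ν : ℕ) {r : ℝ} (hr : 0 < r)
    {u : ℂ} (hu : u * starRingEnd ℂ u = 1) : (a ν * (r * u) ^ ν : ℂ) ≠ 0 := by
  refine mul_ne_zero (by exact_mod_cast (ha ν).ne') (pow_ne_zero _ (mul_ne_zero ?_ ?_))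
  · exact_mod_cast hr.ne'
  · exact left_ne_zero_of_mul_eq_one hu

/-- The equation `f z = 0` relative to the term of index `ν`. -/
lemma hasSum_of_zero (ha : ∀ k, 0 < a k)
    (hf : ∀ z : ℂ, HasSum (fun k : ℕ => (a k : ℂ) * z ^ k) (f z)) (ν : ℕ) {r : ℝ} (hr : 0 < r)
    {u : ℂ} (hu : u * starRingEnd ℂ u = 1) (h : f (r * u) = 0) :
    HasSum (fun j => (upperCoeff a ν r (j + 1) : ℂ) * u ^ (j + 1) +
      lowerCoeff a ν r (j + 1) * (starRingEnd ℂ u) ^ (j + 1)) (-1) := by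
  have h1 := (hf (r * u)).recenter ν
  rw [h, zero_sub] at h1
  refine (hasSum_mul_left_iff (coeff_mul_pow_ne_zero ha ν hr hu)).1 ?_
  rw [mul_neg_one]
  refine h1.congr_fun fun j => ?_
  rw [mul_add, upperCoeff_mul_pow ha]
  split_ifs with hj
  · rw [lowerCoeff_mul_pow ha hj hr hu]
  · rw [lowerCoeff_of_lt (by omega)]
    simp

/-- The equation `f' z = 0` at a real zero, relative to the term of index `ν`. -/
lemma hasSum_of_deriv_zero (ha : ∀ k, 0 < a k)
    (hf : ∀ z : ℂ, HasSum (fun k : ℕ => (a k : ℂ) * z ^ k) (f z)) (ν : ℕ) {r : ℝ} (hr : 0 < r)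
    {u : ℂ} (hu : u * starRingEnd ℂ u = 1) (hu' : starRingEnd ℂ u = u) (h : f (r * u) = 0)
    (h' : HasSum (fun k : ℕ => (k : ℂ) * (a k * (r * u) ^ k)) 0) :
    HasSum (fun j => ((upperCoeff a ν r (j + 1) : ℂ) - lowerCoeff a ν r (j + 1)) *
      conjDivDiff (j + 1) u) 0 := by
  -- The combination z f'(z) - ν f(z) has coefficients (k - ν) a_k, so the central term drops out
  -- and the two sides receive opposite signs.
  have h1 := (h'.sub ((hf (r * u)).mul_left (ν : ℂ))).recenter ν
  rw [h, sub_self, mul_zero, sub_self, sub_self] at h1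
  have hu0 : u ≠ 0 := left_ne_zero_of_mul_eq_one hu
  refine (hasSum_mul_left_iff (mul_ne_zero (coeff_mul_pow_ne_zero ha ν hr hu) hu0)).1 ?_
  rw [mul_zero]
  refine h1.congr_fun fun j => ?_
  have e1 := upperCoeff_mul_pow ha ν (j + 1) r u
  rw [conjDivDiff_of_conj_eq hu', Nat.add_sub_cancel]
  split_ifs with hj
  · have e2 := lowerCoeff_mul_pow ha hj hr hu
    rw [hu'] at e2
    rw [Nat.cast_sub hj]
    push_cast
    linear_combination ((j : ℂ) + 1) * e2 - ((j : ℂ) + 1) * e1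
  · rw [lowerCoeff_of_lt (by omega)]
    push_cast
    linear_combination (-(j : ℂ) - 1) * e1

/-- The imaginary part of `f z = 0` at a non-real zero, relative to the term of index `ν`. -/
lemma hasSum_of_nonreal_zero (ha : ∀ k, 0 < a k)
    (hf : ∀ z : ℂ, HasSum (fun k : ℕ => (a k : ℂ) * z ^ k) (f z)) (ν : ℕ) {r : ℝ} (hr : 0 < r)
    {u : ℂ} (hu : u * starRingEnd ℂ u = 1) (hu' : starRingEnd ℂ u ≠ u) (h : f (r * u) = 0) :
    HasSum (fun j => ((upperCoeff a ν r (j + 1) : ℂ) - lowerCoeff a ν r (j + 1)) *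
      conjDivDiff (j + 1) u) 0 := by
  -- Real coefficients make the conjugate a zero too; the difference of the two equations is
  -- divisible by u - conj u ≠ 0.
  have hconj : f (r * starRingEnd ℂ u) = 0 := by
    have h1 := Complex.hasSum_conj'.2 (hf (r * u))
    rw [h, map_zero] at h1
    refine (hf _).unique (h1.congr_fun fun j => ?_)
    simp
  have h1 := hasSum_of_zero ha hf ν hr hu h
  have h2 := hasSum_of_zero ha hf ν hr (u := starRingEnd ℂ u)
    (by rw [Complex.conj_conj, mul_comm, hu]) hconj
  refine (hasSum_mul_left_iff (sub_ne_zero.2 hu'.symm)).1 ?_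
  rw [mul_zero, ← sub_self (-1 : ℂ)]
  refine (h1.sub h2).congr_fun fun j => ?_
  have := conjDivDiff_mul_sub (j + 1) u
  rw [Complex.conj_conj]
  linear_combination ((upperCoeff a ν r (j + 1) : ℂ) - lowerCoeff a ν r (j + 1)) * this

lemma hasDerivAt_of_hasSum
    (hf : ∀ z : ℂ, HasSum (fun k : ℕ => (a k : ℂ) * z ^ k) (f z)) (z : ℂ) :
    ∃ f' : ℂ, HasDerivAt f f' z ∧ HasSum (fun k : ℕ => (k : ℂ) * (a k * z ^ k)) (z * f') := by
  have hfe : f = fun z => ∑' k : ℕ, (a k : ℂ) * z ^ k := funext fun z => (hf z).tsum_eq.symm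
  have hR : 1 ≤ ‖z‖ + 1 := by linarith [norm_nonneg z]
  -- Doubling the radius absorbs the factor k of the derivative, as k ≤ 2^k.
  have hs : Summable fun k : ℕ => ‖(a k : ℂ) * ((2 * (‖z‖ + 1) : ℝ) : ℂ) ^ k‖ :=
    (hf _).summable.norm
  have hb : ∀ (k : ℕ) (y : ℂ), y ∈ Metric.ball (0 : ℂ) (‖z‖ + 1) →
      ‖(a k : ℂ) * ((k : ℂ) * y ^ (k - 1))‖ ≤ ‖(a k : ℂ) * ((2 * (‖z‖ + 1) : ℝ) : ℂ) ^ k‖ := by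
    intro k y hy
    rw [mem_ball_zero_iff] at hy
    rw [norm_mul, norm_mul, norm_mul, norm_pow, norm_pow, Complex.norm_real (2 * (‖z‖ + 1)),
      Real.norm_of_nonneg (by positivity), mul_pow, Complex.norm_natCast]
    refine mul_le_mul_of_nonneg_left ?_ (norm_nonneg _)
    refine mul_le_mul (by exact_mod_cast Nat.lt_two_pow_self.le) ?_ (by positivity) (by positivity)
    exact (pow_le_pow_left₀ (norm_nonneg _) hy.le _).trans (pow_le_pow_right₀ hR (Nat.sub_le _ _))
  have hz : z ∈ Metric.ball (0 : ℂ) (‖z‖ + 1) := by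
    rw [mem_ball_zero_iff]
    linarith
  have hd := hasDerivAt_tsum_of_isPreconnected hs Metric.isOpen_ball
    (convex_ball (0 : ℂ) _).isPreconnected (g := fun (k : ℕ) (y : ℂ) => (a k : ℂ) * y ^ k)
    (fun k y _ => (hasDerivAt_pow k y).const_mul (a k : ℂ)) hb hz (hf z).summable hz
  rw [← hfe] at hd
  refine ⟨_, hd, ?_⟩
  have hsum : Summable fun k : ℕ => (a k : ℂ) * ((k : ℂ) * z ^ (k - 1)) :=
    Summable.of_norm_bounded hs fun k => hb k z hz
  refine (hsum.hasSum.mul_left z).congr_fun fun k => ?_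
  rcases k with _ | k
  · simp
  · rw [Nat.add_sub_cancel, pow_succ]
    ring

end Zeros

/-! ### Non-real or multiple zeros, and discreteness of the zero set. -/

section Bad

variable {a : ℕ → ℝ} {f : ℂ → ℂ}

lemma differentiable_of_hasSum
    (hf : ∀ z : ℂ, HasSum (fun k : ℕ => (a k : ℂ) * z ^ k) (f z)) : Differentiable ℂ f := fun z =>
  let ⟨_, h, _⟩ := hasDerivAt_of_hasSum hf z
  h.differentiableAt

/-- At a non-real or multiple zero the conjugate divided difference of `f` vanishes. -/
lemma hasSum_conjDivDiff_eq_zero (ha : ∀ k, 0 < a k)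
    (hf : ∀ z : ℂ, HasSum (fun k : ℕ => (a k : ℂ) * z ^ k) (f z)) (ν : ℕ) {r : ℝ} (hr : 0 < r)
    {u : ℂ} (hu : u * starRingEnd ℂ u = 1) (h : f (r * u) = 0)
    (hbad : ¬ ((r * u : ℂ).im = 0 ∧ IsSimpleZero f (r * u))) :
    HasSum (fun j => ((upperCoeff a ν r (j + 1) : ℂ) - lowerCoeff a ν r (j + 1)) *
      conjDivDiff (j + 1) u) 0 := by
  by_cases hu' : starRingEnd ℂ u = u
  · refine hasSum_of_deriv_zero ha hf ν hr hu hu' h ?_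
    have him : (r * u : ℂ).im = 0 := by
      rw [Complex.im_ofReal_mul, Complex.conj_eq_iff_im.1 hu', mul_zero]
    have han : AnalyticAt ℂ f (r * u) := (differentiable_of_hasSum hf).analyticAt _
    obtain ⟨f', hf', hs⟩ := hasDerivAt_of_hasSum hf (r * u)
    have : deriv f (r * u) = 0 := by
      by_contra hne
      exact hbad ⟨him, han, han.analyticOrderAt_eq_one_of_zero_deriv_ne_zero h hne⟩
    rw [hf'.deriv] at this
    rwa [this, mul_zero] at hs
  · exact hasSum_of_nonreal_zero ha hf ν hr hu hu' h

lemma finite_zeros_inter_closedBall (ha : ∀ k, 0 < a k)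
    (hf : ∀ z : ℂ, HasSum (fun k : ℕ => (a k : ℂ) * z ^ k) (f z)) (R : ℝ) :
    (Metric.closedBall 0 R ∩ f ⁻¹' {0}).Finite := by
  have hd := differentiable_of_hasSum hf
  have h0 : f 0 ≠ 0 := by
    have h1 : HasSum (fun k : ℕ => (a k : ℂ) * (0 : ℂ) ^ k) (a 0 * 0 ^ 0) :=
      hasSum_single 0 fun k hk => by simp [hk]
    rw [(hf 0).unique h1]
    simpa using (ha 0).ne'
  have hc : (f ⁻¹' {0})ᶜ ∈ codiscrete ℂ :=
    AnalyticOnNhd.preimage_zero_mem_codiscrete (fun z _ => hd.analyticAt z) h0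
  have hc' := mem_codiscrete'.1 hc
  rw [compl_compl] at hc'
  refine ((isCompact_closedBall 0 R).inter_right
    (isClosed_singleton.preimage hd.continuous)).finite ?_
  exact hc'.2.mono Set.inter_subset_right

end Bad

/-! ### The compactness argument and the conclusion. -/

/-- Beyond all bounds there are only real simple zeros, for coefficients whose consecutive ratios
have ratios at most `2 / 5` that are decreasing. -/
lemma finite_bad_zeros {a : ℕ → ℝ} {f : ℂ → ℂ} (ha : ∀ k, 0 < a k)
    (hf : ∀ z : ℂ, HasSum (fun k : ℕ => (a k : ℂ) * z ^ k) (f z))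
    (hT : ∀ k, coeffRatio a k / coeffRatio a (k + 1) ≤ 2 / 5)
    (hanti : Antitone fun k => coeffRatio a k / coeffRatio a (k + 1)) :
    {z : ℂ | f z = 0 ∧ ¬ (z.im = 0 ∧ IsSimpleZero f z)}.Finite := by
  by_contra hinf
  have hlarge : ∀ R : ℝ, ∃ z : ℂ, R < ‖z‖ ∧ f z = 0 ∧ ¬ (z.im = 0 ∧ IsSimpleZero f z) := by
    intro R
    by_contra! hcon
    refine hinf ((finite_zeros_inter_closedBall ha hf R).subset fun z hz => ⟨?_, hz.1⟩)
    rw [mem_closedBall_zero_iff]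
    by_contra! hlt
    exact hz.2 (hcon z hlt hz.1)
  have hpos := coeffRatio_pos ha
  have hstep : ∀ k, 5 / 2 * coeffRatio a k ≤ coeffRatio a (k + 1) := fun k => by
    have := (div_le_iff₀ (hpos (k + 1))).1 (hT k)
    linarith
  have hmono : Monotone (coeffRatio a) := monotone_nat_of_le_succ fun k => by
    linarith [hstep k, hpos k]
  have htop : Tendsto (coeffRatio a) atTop atTop := by
    have hge : ∀ k, coeffRatio a 0 * (5 / 2) ^ k ≤ coeffRatio a k := by
      intro k
      induction k with
      | zero => simp
      | succ k ih => rw [pow_succ]; linarith [hstep k]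
    exact tendsto_atTop_mono hge
      ((tendsto_pow_atTop_atTop_of_one_lt (by norm_num)).const_mul_atTop (hpos 0))
  obtain ⟨t, ht⟩ : ∃ t, Tendsto (fun k => coeffRatio a k / coeffRatio a (k + 1)) atTop (𝓝 t) :=
    ⟨_, tendsto_atTop_ciInf hanti ⟨0, by
      rintro _ ⟨k, rfl⟩
      exact (div_pos (hpos _) (hpos _)).le⟩⟩
  -- The radius ρ_0 + m both drives the zeros to infinity and keeps |z_m| above ρ_0, so that an
  -- index `v` exists.
  choose z hzR hz0 hzbad using fun m : ℕ => hlarge (coeffRatio a 0 + m)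
  have hr : ∀ m, 0 < ‖z m‖ := fun m => by
    linarith [hpos 0, hzR m, (Nat.cast_nonneg m : (0 : ℝ) ≤ m)]
  have hex : ∀ m, ∃ v, coeffRatio a v ≤ ‖z m‖ ∧ ‖z m‖ < coeffRatio a (v + 1) := by
    intro m
    have hE : ∃ k, ‖z m‖ < coeffRatio a k := (htop.eventually_gt_atTop _).exists
    classical
    obtain ⟨v, hv⟩ : ∃ v, Nat.find hE = v + 1 := by
      refine Nat.exists_eq_succ_of_ne_zero fun h => ?_
      have := Nat.find_spec hE
      rw [h] at this
      linarith [hzR m, (Nat.cast_nonneg m : (0 : ℝ) ≤ m)]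
    refine ⟨v, not_lt.1 (Nat.find_min hE (by omega)), ?_⟩
    rw [← hv]
    exact Nat.find_spec hE
  choose v hv1 hv2 using hex
  have hvtop : Tendsto v atTop atTop := by
    refine tendsto_atTop.2 fun N => ?_
    filter_upwards [tendsto_natCast_atTop_atTop.eventually_ge_atTop (coeffRatio a N)] with m hm
    by_contra! hlt
    have := hmono (show v m + 1 ≤ N by omega)
    linarith [hv2 m, hzR m, hpos 0]
  set u : ℕ → ℂ := fun m => z m / ‖z m‖ with hu
  have hun : ∀ m, ‖u m‖ = 1 := fun m => by
    rw [hu]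
    simp [(hr m).ne']
  have hzu : ∀ m, (‖z m‖ : ℂ) * u m = z m := fun m =>
    mul_div_cancel₀ _ (by exact_mod_cast (hr m).ne')
  have huc : ∀ m, u m * starRingEnd ℂ (u m) = 1 := fun m => by
    rw [Complex.mul_conj, Complex.normSq_eq_norm_sq, hun]
    simp
  set p : ℕ → ℝ × ℝ × ℂ := fun m =>
    (‖z m‖ / coeffRatio a (v m + 1), coeffRatio a (v m) / ‖z m‖, u m) with hp
  have hpK : ∀ m, p m ∈ Set.Icc (0 : ℝ) 1 ×ˢ Set.Icc (0 : ℝ) 1 ×ˢ Metric.sphere (0 : ℂ) 1 :=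
    fun m => ⟨⟨by have := hpos (v m + 1); positivity, (div_le_one (hpos _)).2 (hv2 m).le⟩,
      ⟨by have := hpos (v m); positivity, (div_le_one (hr m)).2 (hv1 m)⟩,
      by rw [mem_sphere_zero_iff_norm]; exact hun m⟩
  obtain ⟨⟨α, β, u₀⟩, ⟨hα, hβ, -⟩, φ, hφ, hlim⟩ :=
    (isCompact_Icc.prod (isCompact_Icc.prod (isCompact_sphere (0 : ℂ) 1))).tendsto_subseq hpK
  have hlimα : Tendsto (fun m => ‖z (φ m)‖ / coeffRatio a (v (φ m) + 1)) atTop (𝓝 α) :=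
    hlim.fst_nhds
  have hlimβ : Tendsto (fun m => coeffRatio a (v (φ m)) / ‖z (φ m)‖) atTop (𝓝 β) :=
    hlim.snd_nhds.fst_nhds
  have hlimu : Tendsto (fun m => u (φ m)) atTop (𝓝 u₀) := hlim.snd_nhds.snd_nhds
  have hvφ : Tendsto (fun m => v (φ m)) atTop atTop := hvtop.comp hφ.tendsto_atTop
  -- The radius cancels: the product of the two quotients is ρ_v / ρ_{v+1}.
  have hαβ : α * β = t := by
    refine tendsto_nhds_unique (hlimα.mul hlimβ) ((ht.comp hvφ).congr fun m => ?_)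
    have h1 := hr (φ m)
    have h2 := hpos (v (φ m) + 1)
    simp only [Function.comp]
    field_simp
  have hF : ∀ m, HasSum (fun j => (upperCoeff a (v m + 1) ‖z m‖ (j + 1) : ℂ) * u m ^ (j + 1) +
      lowerCoeff a (v m + 1) ‖z m‖ (j + 1) * (starRingEnd ℂ (u m)) ^ (j + 1)) (-1) := fun m =>
    hasSum_of_zero ha hf _ (hr m) (huc m) (by rw [hzu, hz0])
  have hW : ∀ m, HasSum (fun j => ((upperCoeff a (v m + 1) ‖z m‖ (j + 1) : ℂ) -
      lowerCoeff a (v m + 1) ‖z m‖ (j + 1)) * conjDivDiff (j + 1) (u m)) 0 := fun m =>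
    hasSum_conjDivDiff_eq_zero ha hf _ (hr m) (huc m) (by rw [hzu, hz0])
      (by rw [hzu]; exact hzbad m)
  refine false_of_tendsto_theta (l := atTop) (u := fun m => u (φ m))
    (B := fun m => upperCoeff a (v (φ m) + 1) ‖z (φ m)‖)
    (C := fun m => lowerCoeff a (v (φ m) + 1) ‖z (φ m)‖)
    hα.1 hα.2 hβ.1 hβ.2 hαβ (le_of_tendsto' ht hT) (fun m => hun _) hlimu ?_ ?_
    (tendsto_upperCoeff ha ht (tendsto_atTop_mono (fun _ => Nat.le_succ _) hvφ) hlimα)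
    (tendsto_lowerCoeff ha ht hvφ (fun m => hr _) hlimβ) ?_ fun m => (hW _).tsum_eq
  · intro m n
    rw [abs_of_nonneg (upperCoeff_nonneg ha _ (hr _) n)]
    exact upperCoeff_le ha (by norm_num) hT (hr _) (hv2 _).le n
  · intro m n
    rw [abs_of_nonneg (lowerCoeff_nonneg ha _ (hr _) n)]
    exact lowerCoeff_le ha (by norm_num) hT (hr _) (hv1 _) n
  · intro m
    rw [(hF (φ m)).tsum_eq]
    ring

/-- Amounts to (5/4)³ = 125/64 < 2; only this rational bound on the constant enters the proof. -/
lemma five_halves_le : (5 / 2 : ℝ) ≤ 2 * (2 : ℝ) ^ (1 / 3 : ℝ) := by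
  have h : ((5 / 4 : ℝ) ^ (3 : ℝ)) ^ (1 / 3 : ℝ) ≤ (2 : ℝ) ^ (1 / 3 : ℝ) :=
    Real.rpow_le_rpow (by positivity) (by norm_num) (by norm_num)
  rw [← Real.rpow_mul (by norm_num)] at h
  norm_num at h ⊢
  linarith

theorem theorem1 (a : ℕ → ℝ) (f : ℂ → ℂ)
    (ha : ∀ k, 0 < a k)
    (hf : ∀ z : ℂ, HasSum (fun k : ℕ => (a k : ℂ) * z ^ k) (f z))
    (hq₂ : 2 * (2 : ℝ) ^ (1 / 3 : ℝ) ≤ secondQuotient a 2)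
    (hq : ∀ n : ℕ, 2 ≤ n → secondQuotient a n ≤ secondQuotient a (n + 1)) :
    {z : ℂ | f z = 0 ∧ ¬ (z.im = 0 ∧ IsSimpleZero f z)}.Finite := by
  have hmono : Monotone fun k => secondQuotient a (k + 2) :=
    monotone_nat_of_le_succ fun k => hq (k + 2) (by omega)
  have hge : ∀ k, (5 / 2 : ℝ) ≤ secondQuotient a (k + 2) := fun k =>
    (five_halves_le.trans hq₂).trans (hmono (Nat.zero_le k))
  refine finite_bad_zeros ha hf (fun k => ?_) fun k l hkl => ?_
  · rw [← inv_secondQuotient ha, show (2 / 5 : ℝ) = (5 / 2)⁻¹ by norm_num]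
    exact inv_anti₀ (by norm_num) (hge k)
  · simp only [← inv_secondQuotient ha]
    exact inv_anti₀ (by linarith [hge k]) (hmono hkl)
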